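/- Let $\mathcal B_n$ be the group of signed permutations $w=w_1\ldots w_n$ of $[n]=\{1,\ldots,n\}$, with composition as product, and set $w_0=0$. Let $\mathrm{Des}(w)=\{i\in\{0,1,\ldots,n-1\} : w_i>w_{i+1}\}$, where $\cdots<\bar2<\bar1<0<1<2<\cdots$. For $J\subseteq\{0,\ldots,n-1\}$ let $Y_J=\sum_{\mathrm{Des}(w)=J}w$ and $X_J=\sum_{\mathrm{Des}(w)\subseteq J}w$ in $\mathbb Q\mathcal B_n$. The descent algebra $\Sigma(B_n)$ is the linear span of the $Y_J$; it is a unital subalgebra of $\mathbb Q\mathcal B_n$ with linear basis $\{X_J\}$. For $n\ge 1$ let $\beta:\Sigma(B_n)\to\Sigma(B_{n-1})$ be the linear map with $\beta(X_J)=X_{J-1}$ if $0\notin J$ and $\beta(X_J)=0$ if $0\in J$, where $J-1=\{j-1 : j\in J\}$. The canonical ideal is $I_n^0=\ker\beta$, and $X^0_{(n)}=X_{\{0\}}=\sum_{w_1<w_2<\cdots<w_n}w$. For a permutation $u=u_1\ldots u_n$ in the symmetric group $\mathcal S_n$ set $u_0=0$ and let $\mathrm{Peak}(u)=\{i : 1\le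 i\le n-1,\ u_{i-1}<u_i>u_{i+1}\}$ and $\overset{\circ}{\mathrm{Peak}}(u)=\mathrm{Peak}(u)\setminus\{1\}$. Let $\mathcal F_n$ be the family of the subsets $F$ of $\{1,\ldots,n-1\}$ without two consecutive elements, and $\overset{\circ}{\mathcal F}_n=\{F\in\mathcal F_n : 1\notin F\}$. The peak algebra $\mathcal P_n$ is the linear span in $\mathbb Q\mathcal S_n$ of the elements $P_F=\sum_{\mathrm{Peak}(u)=F}u$, $F\in\mathcal F_n$; it is a unital subalgebra of $\mathbb Q\mathcal S_n$. The peak ideal $\overset{\circ}{\mathcal P}_n$ is the linear span of the elements $\overset{\circ}{P}_F=\sum_{\overset{\circ}{\mathrm{Peak}}(u)=F}u$, $F\in\overset{\circ}{\mathcal F}_n$, and $\overset{\circ}{P}_{(n)}=\overset{\circ}{P}_\emptyset$. **Proposition.** (1) For every $n\ge 1$, $\Sigma(B_n)$ is a unital subalgebra of $\mathbb Q\mathcal B_n$, and $I_n^0$ is the right ideal of $\Sigma(B_n)$ generated by $X^0_{(n)}$; that is, $I_n^0$ is the smallest right ideal of $\Sigma(B_n)$ that contains $X^0_{(n)}$.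 (2) For every $n\ge 0$, $\mathcal P_n$ is a unital subalgebra of $\mathbb Q\mathcal S_n$, and $\overset{\circ}{\mathcal P}_n$ is the right ideal of $\mathcal P_n$ generated by $\overset{\circ}{P}_{(n)}$; that is, $\overset{\circ}{\mathcal P}_n$ is the smallest right ideal of $\mathcal P_n$ that contains $\overset{\circ}{P}_{(n)}$. -/

import Mathlib

/-! ### Signed permutations -/

/-- A signed permutation of `[n]`, written as a word `w₁ … wₙ`: the underlying permutation is
`perm`, and `sign i` is the sign of the letter in position `i` (`-1` means barred). -/
@[ext]
structure SignedPerm (n : ℕ) where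
  perm : Equiv.Perm (Fin n)
  sign : Fin n → ℤˣ

namespace SignedPerm

variable {n : ℕ}

def equivProd (n : ℕ) : SignedPerm n ≃ Equiv.Perm (Fin n) × (Fin n → ℤˣ) where
  toFun w := (w.perm, w.sign)
  invFun p := ⟨p.1, p.2⟩
  left_inv _ := rfl
  right_inv _ := rfl

instance : DecidableEq (SignedPerm n) := (equivProd n).decidableEq

instance : Fintype (SignedPerm n) := Fintype.ofEquiv _ (equivProd n).symm

/-- The product is composition, a signed permutation being extended to barred letters by
`w(-i) = -w(i)`; hence `(u * v)ᵢ = ± u_{|vᵢ|}` with `±` the sign of `vᵢ`. -/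
instance : Mul (SignedPerm n) :=
  ⟨fun u v => ⟨u.perm * v.perm, fun i => u.sign (v.perm i) * v.sign i⟩⟩

instance : One (SignedPerm n) := ⟨⟨1, fun _ => 1⟩⟩

instance : Inv (SignedPerm n) := ⟨fun u => ⟨u.perm⁻¹, fun i => (u.sign (u.perm⁻¹ i))⁻¹⟩⟩

instance : Group (SignedPerm n) :=
  Group.ofLeftAxioms
    (fun u v w => by
      apply SignedPerm.ext
      · exact mul_assoc u.perm v.perm w.perm
      · funext i
        exact mul_assoc (u.sign (v.perm (w.perm i))) (v.sign (w.perm i)) (w.sign i))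
    (fun u => by
      apply SignedPerm.ext
      · exact one_mul u.perm
      · funext i
        exact one_mul (u.sign i))
    (fun u => by
      apply SignedPerm.ext
      · exact inv_mul_cancel u.perm
      · funext i
        change (u.sign (u.perm⁻¹ (u.perm i)))⁻¹ * u.sign i = 1
        simp)

/-- The entries `w₀ = 0, w₁, …, wₙ` of a signed permutation, as integers; the order on barred and
unbarred symbols is the order of `ℤ`. -/
def entry (w : SignedPerm n) : Fin (n + 1) → ℤ :=
  Fin.cons 0 (fun i => (w.sign i : ℤ) * ((w.perm i : ℕ) + 1 : ℤ))

/-- The descent set `{i ∈ {0, 1, …, n-1} | wᵢ > wᵢ₊₁}` of a signed permutation. -/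
def descents (w : SignedPerm n) : Finset (Fin n) :=
  Finset.univ.filter fun i => w.entry i.succ < w.entry i.castSucc

end SignedPerm

/-! ### The descent algebra of type B -/

namespace TypeB

/-- `Y_J`, for `J ⊆ {0, 1, …, n-1}`: the sum of the signed permutations with descent set `J`. -/
noncomputable def Y {n : ℕ} (J : Finset (Fin n)) : MonoidAlgebra ℚ (SignedPerm n) :=
  ∑ w : SignedPerm n with w.descents = J, MonoidAlgebra.of ℚ (SignedPerm n) w

/-- `X_J = ∑_{I ⊆ J} Y_I`. -/
noncomputable def X {n : ℕ} (J : Finset (Fin n)) : MonoidAlgebra ℚ (SignedPerm n) :=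
  ∑ I ∈ J.powerset, Y I

/-- The descent algebra `Σ(B_n)`: the span of the `Y_J`. -/
noncomputable def descentAlgebra (n : ℕ) : Submodule ℚ (MonoidAlgebra ℚ (SignedPerm n)) :=
  Submodule.span ℚ (Set.range (Y (n := n)))

/-- `X⁰_J = X_{{0} ∪ J}`. -/
noncomputable def X0 {n : ℕ} (J : Finset (Fin n)) : MonoidAlgebra ℚ (SignedPerm n) :=
  X ((Finset.univ.filter fun i : Fin n => (i : ℕ) = 0) ∪ J)

/-- `{i | i + 1 ∈ J} ⊆ {0, …, n-2}`; this is `J - 1` when `0 ∉ J`. -/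
def shiftDown {n : ℕ} (J : Finset (Fin n)) : Finset (Fin (n - 1)) :=
  Finset.univ.filter fun i => (⟨(i : ℕ) + 1, by omega⟩ : Fin n) ∈ J

/-- A signed permutation with descent set `J`. -/
def ofDescents {n : ℕ} (J : Finset (Fin n)) : SignedPerm n :=
  ⟨1, fun i => if i ∈ J then -1 else 1⟩

theorem descents_ofDescents {n : ℕ} (J : Finset (Fin n)) : (ofDescents J).descents = J := by
  have key : ∀ i : Fin n,
      (ofDescents J).entry i.succ = if i ∈ J then -((i : ℤ) + 1) else (i : ℤ) + 1 := by
    intro i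
    simp only [SignedPerm.entry, Fin.cons_succ, ofDescents]
    split_ifs <;> simp
  have bound : ∀ i : Fin (n + 1), |(ofDescents J).entry i| = (i : ℤ) := by
    intro i
    refine Fin.cases ?_ (fun j => ?_) i
    · simp [SignedPerm.entry]
    · rw [key]
      split_ifs
      · rw [abs_neg, abs_of_nonneg (by positivity)]; simp
      · rw [abs_of_nonneg (by positivity)]; simp
  ext i
  simp only [SignedPerm.descents, Finset.mem_filter, Finset.mem_univ, true_and]
  have h1 := key i
  have h2 := bound i.castSucc
  rw [Fin.val_castSucc] at h2
  have h3 := abs_le.1 h2.le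
  by_cases h : i ∈ J
  · simp only [h, iff_true]
    rw [if_pos h] at h1
    linarith [h3.1]
  · simp only [h, iff_false, not_lt]
    rw [if_neg h] at h1
    linarith [h3.2]

theorem coeff_Y {n : ℕ} (I J : Finset (Fin n)) :
    (Y I).coeff (ofDescents J) = if J = I then 1 else 0 := by
  classical
  rw [Y, MonoidAlgebra.coeff_sum, Finset.sum_apply']
  simp only [MonoidAlgebra.of_apply, MonoidAlgebra.coeff_single, Finsupp.single_apply]
  rw [Finset.sum_ite_eq']
  simp [descents_ofDescents]

theorem coeff_X {n : ℕ} (I J : Finset (Fin n)) :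
    (X I).coeff (ofDescents J) = if J ⊆ I then 1 else 0 := by
  rw [X, MonoidAlgebra.coeff_sum, Finset.sum_apply']
  simp only [coeff_Y]
  rw [Finset.sum_ite_eq]
  simp [Finset.mem_powerset]

theorem X_mem {n : ℕ} (J : Finset (Fin n)) : X J ∈ descentAlgebra n :=
  Submodule.sum_mem _ fun I _ => Submodule.subset_span ⟨I, rfl⟩

theorem Y_mem_span_X {n : ℕ} (J : Finset (Fin n)) :
    Y J ∈ Submodule.span ℚ (Set.range (X (n := n))) := by
  induction J using Finset.strongInduction with
  | H J ih =>
    have h : Y J = X J - ∑ I ∈ J.ssubsets, Y I := by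
      rw [X, Finset.ssubsets, ← Finset.add_sum_erase _ _ (Finset.mem_powerset_self J)]
      abel
    rw [h]
    exact Submodule.sub_mem _ (Submodule.subset_span ⟨J, rfl⟩)
      (Submodule.sum_mem _ fun I hI => ih I (Finset.mem_ssubsets.1 hI))

theorem linearIndependent_X (n : ℕ) : LinearIndependent ℚ (X (n := n)) := by
  rw [Fintype.linearIndependent_iff]
  intro g hg
  have hc : ∀ J : Finset (Fin n), ∑ I, g I * (if J ⊆ I then 1 else 0) = 0 := by
    intro J
    have := congrArg (fun a => MonoidAlgebra.coeff a (ofDescents J)) hg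
    simp only [MonoidAlgebra.coeff_sum, Finset.sum_apply', MonoidAlgebra.coeff_smul,
      Finsupp.smul_apply, coeff_X, MonoidAlgebra.coeff_zero, Finsupp.coe_zero, Pi.zero_apply,
      smul_eq_mul] at this
    exact this
  have key : ∀ (k : ℕ) (J : Finset (Fin n)), n - J.card = k → g J = 0 := by
    intro k
    induction k using Nat.strong_induction_on with
    | _ k ih =>
      intro J hJ
      have h := hc J
      rw [Finset.sum_eq_single J] at h
      · simpa using h
      · intro I _ hne
        by_cases hs : J ⊆ I
        · have hlt := Finset.card_lt_card (hs.ssubset_of_ne hne.symm)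
          have hle := I.card_le_univ
          rw [Fintype.card_fin] at hle
          rw [ih (n - I.card) (by omega) I rfl, zero_mul]
        · simp [hs]
      · simp
  exact fun J => key _ J rfl

/-- The basis `{X_J | J ⊆ {0, 1, …, n-1}}` of `Σ(B_n)`. -/
noncomputable def basisX (n : ℕ) : Module.Basis (Finset (Fin n)) ℚ (descentAlgebra n) :=
  Module.Basis.mk (v := fun J => (⟨X J, X_mem J⟩ : descentAlgebra n))
    (LinearIndependent.of_comp (descentAlgebra n).subtype (linearIndependent_X n))
    (by
      rintro ⟨a, ha⟩ -
      have h : a ∈ Submodule.span ℚ (Set.range (X (n := n))) :=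
        (Submodule.span_le.2 (by rintro _ ⟨J, rfl⟩; exact Y_mem_span_X J)) ha
      have e : Set.range (X (n := n)) = (descentAlgebra n).subtype ''
          Set.range (fun J => (⟨X J, X_mem J⟩ : descentAlgebra n)) := by
        rw [← Set.range_comp]; rfl
      rw [e, ← Submodule.map_span] at h
      obtain ⟨b, hb, hba⟩ := h
      have : b = ⟨a, ha⟩ := Subtype.ext hba
      exact this ▸ hb)

theorem coe_basisX {n : ℕ} (J : Finset (Fin n)) :
    (basisX n J : MonoidAlgebra ℚ (SignedPerm n)) = X J := by
  simp [basisX]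

/-- The linear map `β : Σ(B_n) → Σ(B_{n-1})` with `X_J ↦ X_{J-1}` if `0 ∉ J` and `X_J ↦ 0` if
`0 ∈ J`; it is used for `n ≥ 1` only. -/
noncomputable def beta (n : ℕ) : descentAlgebra n →ₗ[ℚ] descentAlgebra (n - 1) :=
  (basisX n).constr ℚ fun J =>
    if ∃ i ∈ J, (i : ℕ) = 0 then 0 else basisX (n - 1) (shiftDown J)

theorem coe_beta_X {n : ℕ} (J : Finset (Fin n)) :
    (beta n ⟨X J, X_mem J⟩ : MonoidAlgebra ℚ (SignedPerm (n - 1))) =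
      if ∃ i ∈ J, (i : ℕ) = 0 then 0 else X (shiftDown J) := by
  have h : (⟨X J, X_mem J⟩ : descentAlgebra n) = basisX n J := Subtype.ext (coe_basisX J).symm
  rw [h, beta, Module.Basis.constr_basis]
  split_ifs
  · rfl
  · exact coe_basisX _

/-- The canonical ideal `I⁰_n = ker β`, as a subspace of the group algebra. -/
noncomputable def canonicalIdeal (n : ℕ) : Submodule ℚ (MonoidAlgebra ℚ (SignedPerm n)) :=
  (LinearMap.ker (beta n)).map (descentAlgebra n).subtype

end TypeB

/-! ### The peak algebra and the peak ideal -/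

namespace Peak

/-- The letters `u₀ = 0, u₁, …, uₙ` of a permutation of `[n]` (`letter u k` is `0` for `k > n`,
a value that is never used). -/
def letter {n : ℕ} (u : Equiv.Perm (Fin n)) (k : ℕ) : ℕ :=
  if h : 1 ≤ k ∧ k ≤ n then (u ⟨k - 1, by omega⟩ : ℕ) + 1 else 0

/-- `Peak(u) = {i ∈ {1, …, n-1} | uᵢ₋₁ < uᵢ > uᵢ₊₁}`, with `u₀ = 0`. -/
def peaks {n : ℕ} (u : Equiv.Perm (Fin n)) : Finset ℕ :=
  (Finset.Icc 1 (n - 1)).filter fun i =>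
    letter u (i - 1) < letter u i ∧ letter u (i + 1) < letter u i

/-- The interior peaks `{i ∈ {2, …, n-1} | uᵢ₋₁ < uᵢ > uᵢ₊₁}`. -/
def interiorPeaks {n : ℕ} (u : Equiv.Perm (Fin n)) : Finset ℕ :=
  (Finset.Icc 2 (n - 1)).filter fun i =>
    letter u (i - 1) < letter u i ∧ letter u (i + 1) < letter u i

/-- `𝓕_n`: the subsets of `{1, …, n-1}` without two consecutive elements. -/
def peakSets (n : ℕ) : Set (Finset ℕ) :=
  {F | F ⊆ Finset.Icc 1 (n - 1) ∧ ∀ i ∈ F, i + 1 ∉ F}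

/-- `P_F`: the sum of the permutations of `[n]` with peak set `F`. -/
noncomputable def P (n : ℕ) (F : Finset ℕ) : MonoidAlgebra ℚ (Equiv.Perm (Fin n)) :=
  ∑ u : Equiv.Perm (Fin n) with peaks u = F, MonoidAlgebra.of ℚ (Equiv.Perm (Fin n)) u

/-- `P°_F`: the sum of the permutations of `[n]` with set of interior peaks `F`. -/
noncomputable def Pint (n : ℕ) (F : Finset ℕ) : MonoidAlgebra ℚ (Equiv.Perm (Fin n)) :=
  ∑ u : Equiv.Perm (Fin n) with interiorPeaks u = F, MonoidAlgebra.of ℚ (Equiv.Perm (Fin n)) u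

/-- The peak algebra `𝓟_n`. -/
noncomputable def peakAlgebra (n : ℕ) : Submodule ℚ (MonoidAlgebra ℚ (Equiv.Perm (Fin n))) :=
  Submodule.span ℚ (P n '' peakSets n)

/-- The peak ideal `𝓟°_n`. -/
noncomputable def peakIdeal (n : ℕ) : Submodule ℚ (MonoidAlgebra ℚ (Equiv.Perm (Fin n))) :=
  Submodule.span ℚ (Pint n '' {F | F ∈ peakSets n ∧ 1 ∉ F})

end Peak

/-! ### Right ideals of a subalgebra given as a subspace -/

/-- `A` is a unital subalgebra of `R`. -/
def IsUnitalSubalgebra {R : Type*} [Ring R] [Algebra ℚ R] (A : Submodule ℚ R) : Prop :=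
  1 ∈ A ∧ ∀ a ∈ A, ∀ b ∈ A, a * b ∈ A

/-- `I` is a right ideal of the unital subalgebra `A` of `R`. -/
def IsRightIdealOf {R : Type*} [Ring R] [Algebra ℚ R] (A I : Submodule ℚ R) : Prop :=
  I ≤ A ∧ ∀ y ∈ I, ∀ a ∈ A, y * a ∈ I

/-- `I` is the right ideal of the unital subalgebra `A` of `R` generated by `x`: the least right
ideal of `A` that contains `x`. -/
def IsRightIdealGeneratedBy {R : Type*} [Ring R] [Algebra ℚ R] (A I : Submodule ℚ R) (x : R) :
    Prop :=
  IsLeast {K : Submodule ℚ R | IsRightIdealOf A K ∧ x ∈ K} I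

/-! Let `block J` count the elements of J weakly below each position. Then Des(u) ⊆ J holds exactly
when the word (2n+1)·`block J` + u is positive and strictly increasing. Acting by v on the right
turns this word into (2n+1)c + w, where w = uv and c is the image of `block J` under v; v is the
signed standardization of the result, so w and c determine it. For fixed w, the factorizations w =
uv with Des(u) ⊆ J thus correspond to the words c in the orbit of `block J`, and Des(v) ⊆ K becomes:
c descends only in K, and Des(w) ⊆ K ∪ `jumps c`. Summing over w gives `X_mul_X`.

If 0 ∈ J, then `block J` vanishes nowhere, so 0 is a jump of every c. Hence the X_L with 0 ∈ L span
a right ideal, which is ker β for n ≥ 1. For 0 ∈ K, the product X_{0} X_K is a positive multiple of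
X_K plus terms X_L with L strictly larger, and downward induction on K shows that X_{0} generates
this ideal.

Part (2) is the image of these facts under forgetting signs. Whether adjacent letters form a descent
depends only on the sign of the one larger in absolute value, and a peak is a letter that decides
two comparisons. Counting signings sends Y_J to the sum of 2^|F| P_F over F ⊆ `boundary n J`, which
is triangular; so Σ(B_n) maps onto the peak algebra. Ignoring position 0 gives likewise that the
span of the X_L with 0 ∈ L maps onto the peak ideal, its generator going to a nonzero multiple of
P°_∅. -/

/-! ### Descents of integer words -/

namespace SignedWord

variable {n : ℕ}

/-- The entry preceding position `i` in the word `0, g 0, …, g (n-1)`. -/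
def pre (g : Fin n → ℤ) (i : Fin n) : ℤ :=
  if (i : ℕ) = 0 then 0 else g ⟨(i : ℕ) - 1, by omega⟩

/-- The descent set of the word `0, g 0, …, g (n-1)`. -/
def desc (g : Fin n → ℤ) : Finset (Fin n) :=
  Finset.univ.filter fun i => g i < pre g i

theorem mem_desc {g : Fin n → ℤ} {i : Fin n} : i ∈ desc g ↔ g i < pre g i := by
  simp [desc]

theorem cons_castSucc (g : Fin n → ℤ) (i : Fin n) :
    (Fin.cons 0 g : Fin (n + 1) → ℤ) i.castSucc = pre g i := by
  obtain ⟨i, hi⟩ := i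
  cases i with
  | zero => simp [pre]
  | succ k =>
    have : (Fin.castSucc ⟨k + 1, hi⟩ : Fin (n + 1)) = Fin.succ ⟨k, by omega⟩ := rfl
    rw [this, Fin.cons_succ]
    simp [pre]

/-- The letters of a signed permutation, as integers. -/
def val (w : SignedPerm n) (i : Fin n) : ℤ := (w.sign i : ℤ) * ((w.perm i : ℕ) + 1 : ℤ)

theorem descents_eq (w : SignedPerm n) : w.descents = desc (val w) := by
  ext i
  simp only [SignedPerm.descents, SignedPerm.entry, Finset.mem_filter, Finset.mem_univ, true_and,
    mem_desc, Fin.cons_succ]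
  exact iff_of_eq (congrArg (fun z => val w i < z) (cons_castSucc (val w) i))

theorem pre_lt_iff {f : Fin n → ℤ} :
    (∀ i, pre f i < f i) ↔ StrictMono f ∧ ∀ i, 0 < f i := by
  constructor
  · intro h
    have hs : ∀ (k : ℕ) (hk : k + 1 < n), f ⟨k, by omega⟩ < f ⟨k + 1, hk⟩ := fun k hk => by
      simpa [pre] using h ⟨k + 1, hk⟩
    have hm : ∀ (d k : ℕ) (hk : k + d < n), f ⟨k, by omega⟩ + d ≤ f ⟨k + d, hk⟩ := by
      intro d
      induction d with
      | zero => intro k hk; simp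
      | succ d ih =>
        intro k hk
        have h1 := ih k (by omega)
        have h2 := hs (k + d) (by omega)
        push_cast
        have h3 : f ⟨k + d + 1, by omega⟩ = f ⟨k + (d + 1), hk⟩ := rfl
        omega
    refine ⟨fun a b hab => ?_, fun i => ?_⟩
    · have h1 := hm ((b : ℕ) - a) a (by omega)
      have h2 : (⟨(a : ℕ) + ((b : ℕ) - a), by omega⟩ : Fin n) = b := by
        have : (a : ℕ) < b := hab
        exact Fin.ext (by change (a : ℕ) + ((b : ℕ) - a) = b; omega)
      rw [h2] at h1
      have : (a : ℕ) < b := hab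
      have h4 : f ⟨a, by omega⟩ = f a := rfl
      omega
    · have h0 := h ⟨0, i.pos⟩
      have h1 := hm i 0 (by have := i.isLt; omega)
      have h2 : (⟨0 + (i : ℕ), by omega⟩ : Fin n) = i := by ext; simp
      rw [h2] at h1
      simp only [pre, if_true] at h0
      omega
  · rintro ⟨hm, hp⟩ i
    unfold pre
    split_ifs with h
    · exact hp i
    · exact hm (by rw [Fin.lt_def]; simp only; omega)

/-! ### Signed standardization of integer words -/

/-- The right action of signed permutations on integer words, extended oddly to barred letters. -/
def act (f : Fin n → ℤ) (v : SignedPerm n) (i : Fin n) : ℤ := (v.sign i : ℤ) * f (v.perm i)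

theorem act_mul (f : Fin n → ℤ) (u v : SignedPerm n) : act (act f u) v = act f (u * v) := by
  funext i
  change (v.sign i : ℤ) * ((u.sign (v.perm i) : ℤ) * f (u.perm (v.perm i))) =
    ((u.sign (v.perm i) * v.sign i : ℤˣ) : ℤ) * f (u.perm (v.perm i))
  push_cast
  ring

theorem act_val (u v : SignedPerm n) : act (val u) v = val (u * v) :=
  act_mul (fun a : Fin n => ((a : ℕ) + 1 : ℤ)) u v

theorem act_one (f : Fin n → ℤ) : act f 1 = f := by
  funext i
  change ((1 : ℤˣ) : ℤ) * f i = f i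
  simp

theorem act_mul_add (N : ℤ) (f g : Fin n → ℤ) (v : SignedPerm n) :
    act (fun i => N * f i + g i) v = fun i => N * act f v i + act g v i := by
  funext i
  simp only [act]
  ring

theorem sign_mul_lt_iff {f g : Fin n → ℤ} (hf : StrictMono f) (hf0 : ∀ i, 0 < f i)
    (hg : StrictMono g) (hg0 : ∀ i, 0 < g i) (s t : ℤˣ) (a b : Fin n) :
    (s : ℤ) * f a < t * f b ↔ (s : ℤ) * g a < t * g b := by
  have := hf0 a; have := hf0 b; have := hg0 a; have := hg0 b
  rcases Int.units_eq_one_or s with rfl | rfl <;> rcases Int.units_eq_one_or t with rfl | rfl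
  · simpa using hf.lt_iff_lt.trans hg.lt_iff_lt.symm
  · simp; omega
  · simp; omega
  · simpa using hf.lt_iff_lt.trans hg.lt_iff_lt.symm

/-- Signed letters taken from any positive increasing alphabet compare as those from 1, …, n do. -/
theorem desc_act {f : Fin n → ℤ} (hf : StrictMono f) (hf0 : ∀ i, 0 < f i) (v : SignedPerm n) :
    desc (act f v) = v.descents := by
  rw [descents_eq]
  have hg : StrictMono (fun a : Fin n => ((a : ℕ) + 1 : ℤ)) := fun a b hab => by
    have : (a : ℕ) < b := hab
    simp only; omega
  have hg0 : ∀ a : Fin n, 0 < ((a : ℕ) + 1 : ℤ) := fun a => by positivity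
  ext i
  rw [mem_desc, mem_desc]
  unfold pre
  split_ifs with h
  · change (v.sign i : ℤ) * _ < _ ↔ (v.sign i : ℤ) * _ < _
    have := hf0 (v.perm i); have := hg0 (v.perm i)
    rcases Int.units_eq_one_or (v.sign i) with h | h <;> rw [h] <;> simp <;> omega
  · exact sign_mul_lt_iff hf hf0 hg hg0 _ _ _ _

/-- στ⁻¹ is an order automorphism of a finite chain, hence the identity. -/
theorem perm_eq_of_comp_eq {f g : Fin n → ℤ} (hf : StrictMono f) (hg : StrictMono g)
    {σ τ : Equiv.Perm (Fin n)} (h : ∀ i, f (σ i) = g (τ i)) : σ = τ := by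
  have hm : StrictMono (σ * τ⁻¹) := fun a b hab => by
    have ha := h (τ⁻¹ a)
    have hb := h (τ⁻¹ b)
    rw [Equiv.Perm.coe_inv, Equiv.apply_symm_apply] at ha hb
    rw [← hf.lt_iff_lt]
    change f (σ (τ.symm a)) < f (σ (τ.symm b))
    rw [ha, hb]
    exact hg hab
  have : ∀ a, (σ * τ⁻¹) a = a := by
    intro a
    have h1 := Subsingleton.elim (hm.orderIsoOfSurjective _ (σ * τ⁻¹).surjective)
      (OrderIso.refl (Fin n))
    exact congrArg (fun e : Fin n ≃o Fin n => e a) h1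
  rw [← mul_inv_eq_one]
  exact Equiv.ext this

theorem sign_eq_of_mul_eq {s t : ℤˣ} {x y : ℤ} (hx : 0 < x) (hy : 0 < y)
    (h : (s : ℤ) * x = t * y) : s = t ∧ x = y := by
  rcases Int.units_eq_one_or s with rfl | rfl <;> rcases Int.units_eq_one_or t with rfl | rfl <;>
    simp at h ⊢ <;> omega

/-- Uniqueness of signed standardization: positivity of the alphabets lets the word reveal its
signs, and its absolute values reveal the permutation. -/
theorem act_injective {f g : Fin n → ℤ} (hf : StrictMono f) (hf0 : ∀ i, 0 < f i)
    (hg : StrictMono g) (hg0 : ∀ i, 0 < g i) {v w : SignedPerm n} (h : act f v = act g w) :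
    v = w := by
  have h' := fun i => sign_eq_of_mul_eq (hf0 (v.perm i)) (hg0 (w.perm i)) (congrFun h i)
  exact SignedPerm.ext (perm_eq_of_comp_eq hf hg fun i => (h' i).2) (funext fun i => (h' i).1)

/-- Signed standardization. -/
theorem exists_standardization {g : Fin n → ℤ} (hg : Function.Injective fun i => |g i|)
    (hg0 : ∀ i, g i ≠ 0) :
    ∃ (f : Fin n → ℤ) (v : SignedPerm n), StrictMono f ∧ (∀ i, 0 < f i) ∧ act f v = g := by
  set σ := Tuple.sort fun i => |g i| with hσ
  refine ⟨fun a => |g (σ a)|, ⟨σ⁻¹, fun i => if 0 < g i then 1 else -1⟩, ?_, ?_, ?_⟩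
  · exact (Tuple.monotone_sort fun i => |g i|).strictMono_of_injective (hg.comp σ.injective)
  · exact fun i => abs_pos.2 (hg0 _)
  · funext i
    simp only [act, Equiv.Perm.coe_inv, Equiv.apply_symm_apply]
    split_ifs with h
    · simp [abs_of_pos h]
    · have := hg0 i
      rw [abs_of_neg (by omega)]; simp

theorem abs_val (w : SignedPerm n) (i : Fin n) : |val w i| = (w.perm i : ℕ) + 1 := by
  have h : |((w.perm i : ℕ) + 1 : ℤ)| = (w.perm i : ℕ) + 1 := abs_of_pos (by positivity)
  unfold val
  rw [abs_mul, h]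
  rcases Int.units_eq_one_or (w.sign i) with h | h <;> simp [h]

theorem abs_val_le (w : SignedPerm n) (i : Fin n) : |val w i| ≤ n := by
  rw [abs_val]; have := (w.perm i).isLt; omega

theorem abs_pre_val_le (w : SignedPerm n) (i : Fin n) : |pre (val w) i| ≤ n := by
  unfold pre
  split_ifs
  · simp
  · exact abs_val_le _ _

theorem val_ne_zero (w : SignedPerm n) (i : Fin n) : val w i ≠ 0 :=
  abs_pos.1 (by rw [abs_val w i]; positivity)

theorem abs_val_injective (w : SignedPerm n) : Function.Injective fun i => |val w i| := by
  intro i j h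
  simp only [abs_val] at h
  exact w.perm.injective (Fin.ext (by omega))

/-! ### Lexicographic superposition of words and factorizations -/

/-- Since |x - y| ≤ 2m < 2m + 1, the low-order parts never outweigh a difference of the leading
ones. -/
theorem lex_lt_iff {m c d x y : ℤ} (hx : |x| ≤ m) (hy : |y| ≤ m) :
    (2 * m + 1) * c + x < (2 * m + 1) * d + y ↔ c < d ∨ c = d ∧ x < y := by
  have hx := abs_le.1 hx
  have hy := abs_le.1 hy
  constructor
  · intro h
    rcases lt_trichotomy c d with h1 | h1 | h1
    · exact Or.inl h1
    · subst h1; exact Or.inr ⟨rfl, by linarith⟩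
    · exfalso; nlinarith
  · rintro (h | ⟨rfl, h⟩)
    · nlinarith
    · linarith

theorem lex_eq_iff {m c d x y : ℤ} (hx : |x| ≤ m) (hy : |y| ≤ m)
    (h : (2 * m + 1) * c + x = (2 * m + 1) * d + y) : c = d ∧ x = y := by
  have h1 := (lex_lt_iff (c := c) (d := d) hx hy).not.1 (by linarith)
  have h2 := (lex_lt_iff (c := d) (d := c) hy hx).not.1 (by linarith)
  have : c = d := by omega
  subst this
  exact ⟨rfl, by linarith⟩

theorem pre_lex (m : ℤ) (c g : Fin n → ℤ) (i : Fin n) :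
    pre (fun i => m * c i + g i) i = m * pre c i + pre g i := by
  unfold pre; split_ifs <;> simp

/-- The positions where the word `0, c 0, …, c (n-1)` is not locally constant. -/
def jumps (c : Fin n → ℤ) : Finset (Fin n) := Finset.univ.filter fun i => c i ≠ pre c i

theorem mem_jumps {c : Fin n → ℤ} {i : Fin n} : i ∈ jumps c ↔ c i ≠ pre c i := by
  simp [jumps]

/-- The superposed word descends where c does, and where c is locally constant and w descends. -/
theorem desc_lex_subset_iff (c : Fin n → ℤ) (w : SignedPerm n) (K : Finset (Fin n)) :
    desc (fun i => (2 * n + 1) * c i + val w i) ⊆ K ↔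
      desc c ⊆ K ∧ w.descents ⊆ K ∪ jumps c := by
  have key : ∀ i, i ∈ desc (fun i => (2 * n + 1) * c i + val w i) ↔
      i ∈ desc c ∨ (i ∉ jumps c ∧ i ∈ w.descents) := by
    intro i
    rw [mem_desc, mem_desc, pre_lex, lex_lt_iff (abs_val_le w i) (abs_pre_val_le w i), descents_eq,
      mem_desc]
    simp [jumps]
  constructor
  · intro h
    refine ⟨fun i hi => h ((key i).2 (Or.inl hi)), fun i hi => ?_⟩
    rw [Finset.mem_union]
    by_cases hj : i ∈ jumps c
    · exact Or.inr hj
    · exact Or.inl (h ((key i).2 (Or.inr ⟨hj, hi⟩)))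
  · rintro ⟨h1, h2⟩ i hi
    rcases (key i).1 hi with h | ⟨h, h'⟩
    · exact h1 h
    · exact (Finset.mem_union.1 (h2 h')).resolve_right h

/-- The number of elements of `J` weakly below `a`. -/
def block (J : Finset (Fin n)) (a : Fin n) : ℤ := ((J.filter fun j => j ≤ a).card : ℤ)

theorem block_nonneg (J : Finset (Fin n)) (a : Fin n) : 0 ≤ block J a := by
  unfold block; positivity

theorem block_mono (J : Finset (Fin n)) : Monotone (block J) := fun a b hab => by
  unfold block
  exact_mod_cast Finset.card_le_card fun j hj => by
    rw [Finset.mem_filter] at hj ⊢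
    exact ⟨hj.1, hj.2.trans hab⟩

theorem block_eq (J : Finset (Fin n)) (i : Fin n) :
    block J i = pre (block J) i + if i ∈ J then 1 else 0 := by
  have h : pre (block J) i = ((J.filter fun j => j < i).card : ℤ) := by
    unfold pre
    split_ifs with h
    · rw [eq_comm]
      simp only [Nat.cast_eq_zero, Finset.card_eq_zero, Finset.filter_eq_empty_iff, Fin.lt_def]
      intros; omega
    · unfold block
      congr 3
      ext j
      rw [Fin.le_def, Fin.lt_def]
      simp only; omega
  rw [h]
  unfold block
  have : (J.filter fun j => j ≤ i) = (J.filter fun j => j < i) ∪ (J.filter fun j => j = i) := by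
    ext j; simp only [Finset.mem_filter, Finset.mem_union, le_iff_lt_or_eq]; tauto
  rw [this, Finset.card_union_of_disjoint, Finset.filter_eq']
  · split_ifs <;> simp
  · rw [Finset.disjoint_filter]; intro j _ h; exact h.ne

/-- The superposed word rises at i either because `block J` does, which means i ∈ J, or because u
does. -/
theorem pre_lt_lex_block_iff (J : Finset (Fin n)) (u : SignedPerm n) :
    (StrictMono (fun i => (2 * n + 1) * block J i + val u i) ∧
      ∀ i, 0 < (2 * n + 1) * block J i + val u i) ↔ u.descents ⊆ J := by
  rw [← pre_lt_iff, descents_eq]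
  refine forall_congr' fun i => ?_
  rw [pre_lex, lex_lt_iff (abs_pre_val_le u i) (abs_val_le u i), mem_desc, block_eq J i]
  have hne : val u i ≠ pre (val u) i := by
    unfold pre
    split_ifs with h
    · exact val_ne_zero u i
    · intro h'
      have := abs_val_injective u (congrArg abs h')
      rw [Fin.ext_iff] at this
      simp only at this
      omega
  split_ifs with h
  · simp [h]
  · simp [h, hne.symm.le_iff_lt]

/-- Fixing `w`, the factorizations `w = u * v` with `Des u ⊆ J` are in bijection with the words
in the orbit of `block J`. -/
theorem exists_factor (J : Finset (Fin n)) (w v₀ : SignedPerm n) :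
    ∃ v : SignedPerm n, (w * v⁻¹).descents ⊆ J ∧ act (block J) v = act (block J) v₀ := by
  set c := act (block J) v₀ with hc
  have hinj : Function.Injective fun i => |(2 * n + 1) * c i + val w i| := by
    intro i j h
    rcases abs_eq_abs.1 h with h | h
    · exact abs_val_injective w (congrArg abs (lex_eq_iff (abs_val_le w i) (abs_val_le w j) h).2)
    · have h' : (2 * n + 1) * c i + val w i = (2 * n + 1) * (-c j) + (-val w j) := by
        rw [h]; ring
      have := (lex_eq_iff (abs_val_le w i) (by rw [abs_neg]; exact abs_val_le w j) h').2
      exact abs_val_injective w (by simp only [this, abs_neg])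
  have h0 : ∀ i, (2 * n + 1) * c i + val w i ≠ 0 := by
    intro i h
    have h' : (2 * (n : ℤ) + 1) * c i + val w i = (2 * n + 1) * 0 + 0 := by rw [h]; ring
    exact val_ne_zero w i (lex_eq_iff (abs_val_le w i) (by simp) h').2
  obtain ⟨f, v, hf, hf0, hfv⟩ := exists_standardization hinj h0
  -- Undoing v on the superposed word exhibits f as a superposition again, now with low-order part w
  -- v⁻¹.
  have hfe : f = fun i => (2 * n + 1) * act (block J) (v₀ * v⁻¹) i + val (w * v⁻¹) i := by
    rw [← act_val w v⁻¹, ← act_mul, ← hc, ← act_mul_add, ← hfv, act_mul, mul_inv_cancel, act_one]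
  set b := act (block J) (v₀ * v⁻¹) with hb
  have hpre := pre_lt_iff.2 ⟨hf, hf0⟩
  have hb0 : ∀ i, 0 ≤ b i := by
    intro i
    have h1 : (2 * (n : ℤ) + 1) * 0 + 0 < (2 * n + 1) * b i + val (w * v⁻¹) i := by
      have := hf0 i
      rw [hfe] at this
      simpa using this
    rcases (lex_lt_iff (by simp) (abs_val_le _ i)).1 h1 with h | h
    · exact h.le
    · exact h.1.le
  have hbm : Monotone b := by
    intro i j hij
    rcases hij.eq_or_lt with rfl | hij
    · rfl
    · have h1 := hf hij
      rw [hfe] at h1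
      rcases (lex_lt_iff (abs_val_le _ i) (abs_val_le _ j)).1 h1 with h | h
      · exact h.le
      · exact h.1.le
  -- Each b i is ± a nonnegative number and is itself nonnegative, so a minus sign can only sit on a
  -- zero.
  have hbb : b = block J ∘ (v₀ * v⁻¹).perm := by
    funext i
    have h1 := hb0 i
    have h2 := block_nonneg J ((v₀ * v⁻¹).perm i)
    rw [Function.comp_apply]
    simp only [hb, act] at h1 ⊢
    rcases Int.units_eq_one_or ((v₀ * v⁻¹).sign i) with h | h <;> rw [h] at h1 ⊢ <;>
      simp at h1 ⊢
    omega
  -- Two weakly increasing rearrangements of the same word coincide.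
  have hbeq : b = block J := by
    rw [hbb] at hbm ⊢
    exact Tuple.unique_monotone (τ := 1) hbm (block_mono J)
  refine ⟨v, ?_, ?_⟩
  · rw [← pre_lt_lex_block_iff]
    rw [hfe, hbeq] at hf hf0
    exact ⟨hf, hf0⟩
  · rw [← hbeq, hb, act_mul, inv_mul_cancel_right]

/-- Both v and v' are the standardization of the same superposed word. -/
theorem factor_unique {J : Finset (Fin n)} {w v v' : SignedPerm n}
    (h : (w * v⁻¹).descents ⊆ J) (h' : (w * v'⁻¹).descents ⊆ J)
    (hc : act (block J) v = act (block J) v') : v = v' := by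
  rw [← pre_lt_lex_block_iff] at h h'
  refine act_injective h.1 h.2 h'.1 h'.2 ?_
  rw [act_mul_add, act_mul_add, act_val, act_val, hc, inv_mul_cancel_right, inv_mul_cancel_right]

theorem descents_subset_iff_of_factor {J : Finset (Fin n)} {w v : SignedPerm n}
    (h : (w * v⁻¹).descents ⊆ J) (K : Finset (Fin n)) :
    v.descents ⊆ K ↔
      desc (act (block J) v) ⊆ K ∧ w.descents ⊆ K ∪ jumps (act (block J) v) := by
  rw [← pre_lt_lex_block_iff] at h
  rw [← desc_act h.1 h.2 v, act_mul_add, act_val, inv_mul_cancel_right, desc_lex_subset_iff]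

/-- The orbit of the word `block J` under signed permutations. -/
def orbit (J : Finset (Fin n)) : Finset (Fin n → ℤ) :=
  Finset.univ.image fun v : SignedPerm n => act (block J) v

theorem card_factorizations (J K : Finset (Fin n)) (w : SignedPerm n) :
    (Finset.univ.filter fun v : SignedPerm n =>
      (w * v⁻¹).descents ⊆ J ∧ v.descents ⊆ K).card =
    ((orbit J).filter fun c => desc c ⊆ K ∧ w.descents ⊆ K ∪ jumps c).card := by
  refine Finset.card_bij (fun v _ => act (block J) v) ?_ ?_ ?_
  · intro v hv
    simp only [Finset.mem_filter, Finset.mem_univ, true_and] at hv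
    rw [Finset.mem_filter]
    exact ⟨Finset.mem_image_of_mem _ (Finset.mem_univ v),
      (descents_subset_iff_of_factor hv.1 K).1 hv.2⟩
  · intro v hv v' hv' h
    simp only [Finset.mem_filter, Finset.mem_univ, true_and] at hv hv'
    exact factor_unique hv.1 hv'.1 h
  · intro c hc
    simp only [orbit, Finset.mem_filter, Finset.mem_image, Finset.mem_univ, true_and] at hc
    obtain ⟨⟨v₀, rfl⟩, hc⟩ := hc
    obtain ⟨v, hv, hvc⟩ := exists_factor J w v₀
    refine ⟨v, ?_, hvc⟩
    simp only [Finset.mem_filter, Finset.mem_univ, true_and]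
    exact ⟨hv, (descents_subset_iff_of_factor hv K).2 (by rwa [hvc])⟩

end SignedWord

/-! ### Products in the descent algebra of type B -/

namespace TypeB

open SignedWord

variable {n : ℕ}

theorem X_eq_sum (J : Finset (Fin n)) :
    X J = ∑ w : SignedPerm n with w.descents ⊆ J, MonoidAlgebra.of ℚ (SignedPerm n) w := by
  simp only [X, Y]
  rw [← Finset.sum_fiberwise_of_maps_to (s := Finset.univ.filter fun w => w.descents ⊆ J)
    (t := J.powerset) (g := SignedPerm.descents) (by simp)]
  refine Finset.sum_congr rfl fun I hI => Finset.sum_congr ?_ fun _ _ => rfl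
  ext w
  simp only [Finset.mem_filter, Finset.mem_univ, true_and]
  exact ⟨fun h => ⟨h ▸ Finset.mem_powerset.1 hI, h⟩, fun h => h.2⟩

/-- The multiplication rule of the descent algebra of type B. -/
theorem X_mul_X (J K : Finset (Fin n)) :
    X J * X K = ∑ c ∈ orbit J with desc c ⊆ K, X (K ∪ jumps c) := by
  simp only [X_eq_sum, Finset.sum_filter, Finset.sum_mul_sum]
  rw [Finset.sum_comm]
  have h1 : ∀ v : SignedPerm n, (∑ u : SignedPerm n,
      (if u.descents ⊆ J then MonoidAlgebra.of ℚ (SignedPerm n) u else 0) *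
        (if v.descents ⊆ K then MonoidAlgebra.of ℚ (SignedPerm n) v else 0)) =
      ∑ w : SignedPerm n, if (w * v⁻¹).descents ⊆ J ∧ v.descents ⊆ K then
        MonoidAlgebra.of ℚ (SignedPerm n) w else 0 := by
    intro v
    -- Substitution w = uv for fixed v.
    rw [← Equiv.sum_comp (Equiv.mulRight v) (fun w : SignedPerm n =>
      if (w * v⁻¹).descents ⊆ J ∧ v.descents ⊆ K then MonoidAlgebra.of ℚ (SignedPerm n) w else 0)]
    refine Finset.sum_congr rfl fun u _ => ?_
    simp only [Equiv.coe_mulRight, mul_inv_cancel_right, map_mul]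
    split_ifs <;> simp_all
  simp only [h1]
  rw [Finset.sum_comm]
  have h2 : ∀ c : Fin n → ℤ, (if desc c ⊆ K then ∑ w : SignedPerm n,
      (if w.descents ⊆ K ∪ jumps c then MonoidAlgebra.of ℚ (SignedPerm n) w else 0) else 0) =
      ∑ w : SignedPerm n, if desc c ⊆ K ∧ w.descents ⊆ K ∪ jumps c then
        MonoidAlgebra.of ℚ (SignedPerm n) w else 0 := by
    intro c
    split_ifs with h <;> simp [h]
  simp only [h2]
  rw [Finset.sum_comm (s := orbit J)]
  refine Finset.sum_congr rfl fun w _ => ?_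
  rw [← Finset.sum_filter, ← Finset.sum_filter, Finset.sum_const, Finset.sum_const,
    card_factorizations]

/-! ### The right ideal spanned by the X_L with 0 ∈ L -/

/-- The span of the `X_L` with `D ⊆ L`. -/
noncomputable def upperSpan (D : Finset (Fin n)) : Submodule ℚ (MonoidAlgebra ℚ (SignedPerm n)) :=
  Submodule.span ℚ (X '' {L | D ⊆ L})

theorem X_mem_upperSpan {D L : Finset (Fin n)} (h : D ⊆ L) : X L ∈ upperSpan D :=
  Submodule.subset_span ⟨L, h, rfl⟩

theorem upperSpan_empty : upperSpan (∅ : Finset (Fin n)) = descentAlgebra n := by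
  refine le_antisymm (Submodule.span_le.2 ?_) (Submodule.span_le.2 ?_)
  · rintro _ ⟨L, -, rfl⟩
    exact X_mem L
  · rintro _ ⟨J, rfl⟩
    have := Y_mem_span_X J
    rwa [← Set.image_univ, show (Set.univ : Set (Finset (Fin n))) = {L | ∅ ⊆ L} by ext; simp]
      at this

theorem upperSpan_le_descentAlgebra (D : Finset (Fin n)) : upperSpan D ≤ descentAlgebra n :=
  Submodule.span_le.2 (by rintro _ ⟨L, -, rfl⟩; exact X_mem L)

/-- The singleton `{0}` (empty if `n = 0`). -/
def zeroSet (n : ℕ) : Finset (Fin n) := Finset.univ.filter fun i : Fin n => (i : ℕ) = 0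

theorem mem_zeroSet {i : Fin n} : i ∈ zeroSet n ↔ (i : ℕ) = 0 := by simp [zeroSet]

theorem X0_empty : X0 (∅ : Finset (Fin n)) = X (zeroSet n) := by
  rw [X0, Finset.union_empty]; rfl

theorem zeroSet_subset_jumps {J : Finset (Fin n)} (hJ : zeroSet n ⊆ J) {c : Fin n → ℤ}
    (hc : c ∈ orbit J) : zeroSet n ⊆ jumps c := by
  intro i hi
  have h0 := mem_zeroSet.1 hi
  simp only [orbit, Finset.mem_image, Finset.mem_univ, true_and] at hc
  obtain ⟨v, rfl⟩ := hc
  have hpos : block J (v.perm i) ≠ 0 := by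
    unfold block
    rw [Nat.cast_ne_zero, Finset.card_ne_zero]
    exact ⟨i, Finset.mem_filter.2 ⟨hJ hi, by rw [Fin.le_def]; omega⟩⟩
  rw [mem_jumps, pre, if_pos h0]
  exact mul_ne_zero (Units.ne_zero _) hpos

/-- D is either empty or {0}: the first case gives closure of the descent algebra under products,
the second the right ideal property. -/
theorem upperSpan_mul_mem {D : Finset (Fin n)} (hD : D ⊆ zeroSet n)
    {y a : MonoidAlgebra ℚ (SignedPerm n)} (hy : y ∈ upperSpan D) (ha : a ∈ descentAlgebra n) :
    y * a ∈ upperSpan D := by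
  rw [← upperSpan_empty] at ha
  refine Submodule.span_induction₂ (p := fun y a _ _ => y * a ∈ upperSpan D) ?_ ?_ ?_ ?_ ?_ ?_ ?_
    hy ha
  · rintro _ _ ⟨J, hJ, rfl⟩ ⟨K, -, rfl⟩
    rw [X_mul_X]
    refine Submodule.sum_mem _ fun c hc => X_mem_upperSpan ?_
    rw [Finset.mem_filter] at hc
    rcases Finset.eq_empty_or_nonempty D with rfl | ⟨i, hi⟩
    · exact Finset.empty_subset _
    · refine (hD.trans (zeroSet_subset_jumps (fun j hj => hJ ?_) hc.1)).trans
        Finset.subset_union_right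
      have : j = i := Fin.ext ((mem_zeroSet.1 hj).trans (mem_zeroSet.1 (hD hi)).symm)
      rwa [this]
  · simp
  · simp
  · intro x y z _ _ _ h1 h2; rw [add_mul]; exact Submodule.add_mem _ h1 h2
  · intro x y z _ _ _ h1 h2; rw [mul_add]; exact Submodule.add_mem _ h1 h2
  · intro r x y _ _ h; rw [smul_mul_assoc]; exact Submodule.smul_mem _ _ h
  · intro r x y _ _ h; rw [mul_smul_comm]; exact Submodule.smul_mem _ _ h

/-- A word without descents is positive and increasing, so uniqueness of standardization leaves only
the identity. -/
theorem Y_empty : Y (∅ : Finset (Fin n)) = 1 := by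
  have h : (Finset.univ.filter fun w : SignedPerm n => w.descents = ∅) = {1} := by
    have h1 : (1 : SignedPerm n).descents = ∅ := by
      have h := descents_ofDescents (∅ : Finset (Fin n))
      simp only [ofDescents, Finset.notMem_empty, if_false] at h
      exact h
    have hone : ∀ w : SignedPerm n, w.descents = ∅ →
        StrictMono (val w) ∧ ∀ i, 0 < val w i := by
      intro w hw
      have := (pre_lt_lex_block_iff ∅ w).2 hw.subset
      simpa [block] using this
    ext w
    simp only [Finset.mem_filter, Finset.mem_univ, true_and, Finset.mem_singleton]
    refine ⟨fun hw => ?_, fun hw => hw ▸ h1⟩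
    obtain ⟨ha, hb⟩ := hone w hw
    obtain ⟨hc, hd⟩ := hone 1 h1
    rw [← inv_inj, inv_one]
    refine act_injective ha hb hc hd ?_
    rw [act_val, act_val, mul_inv_cancel, mul_one]
  rw [Y, h, Finset.sum_singleton, map_one]

theorem descentAlgebra_isUnitalSubalgebra (n : ℕ) : IsUnitalSubalgebra (descentAlgebra n) := by
  refine ⟨Submodule.subset_span ⟨∅, Y_empty⟩, fun a ha b hb => ?_⟩
  rw [← upperSpan_empty] at ha ⊢
  exact upperSpan_mul_mem (Finset.empty_subset _) ha hb

theorem one_mem_orbit : (fun _ => 1 : Fin n → ℤ) ∈ orbit (zeroSet n) := by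
  refine Finset.mem_image.2 ⟨1, Finset.mem_univ _, ?_⟩
  rw [act_one]
  funext a
  unfold block
  norm_cast
  rw [Finset.card_eq_one]
  refine ⟨⟨0, a.pos⟩, ?_⟩
  ext j
  simp only [Finset.mem_filter, mem_zeroSet, Finset.mem_singleton, Fin.ext_iff, Fin.le_def]
  omega

/-- Downward induction on the size of K: X_{0} X_K is triangular with nonzero diagonal coefficient.
-/
theorem upperSpan_zeroSet_le_mul :
    upperSpan (zeroSet n) ≤
      (descentAlgebra n).map (LinearMap.mulLeft ℚ (X (zeroSet n))) := by
  set M := (descentAlgebra n).map (LinearMap.mulLeft ℚ (X (zeroSet n)))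
  refine Submodule.span_le.2 ?_
  rintro _ ⟨K, hK, rfl⟩
  change zeroSet n ⊆ K at hK
  have key : ∀ (d : ℕ) (K : Finset (Fin n)), n - K.card = d → zeroSet n ⊆ K → X K ∈ M := by
    intro d
    induction d using Nat.strong_induction_on with
    | _ d ih =>
      intro K hd hK
      have hprod : X (zeroSet n) * X K ∈ M := ⟨X K, X_mem K, rfl⟩
      set S := (orbit (zeroSet n)).filter fun c => desc c ⊆ K with hS
      -- The constant word 1 is `block {0}`; it has no descents and jumps only at 0 ∈ K, so X_K does
      -- occur in the product.
      have h1S : (fun _ => 1 : Fin n → ℤ) ∈ S.filter fun c => jumps c ⊆ K := by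
        rw [hS, Finset.filter_filter, Finset.mem_filter]
        refine ⟨one_mem_orbit, fun i hi => ?_, fun i hi => hK ?_⟩
        · rw [mem_desc] at hi
          unfold pre at hi
          split_ifs at hi <;> simp at hi
        · rw [mem_jumps] at hi
          rw [mem_zeroSet]
          by_contra h
          simp [pre, h] at hi
      rw [X_mul_X, ← Finset.sum_filter_add_sum_filter_not _ (fun c => jumps c ⊆ K)] at hprod
      have hsame : ∑ c ∈ S.filter (fun c => jumps c ⊆ K), X (K ∪ jumps c) =
          ((S.filter fun c => jumps c ⊆ K).card : ℚ) • X K := by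
        rw [Finset.sum_congr rfl (g := fun _ => X K), Finset.sum_const, Nat.cast_smul_eq_nsmul]
        intro c hc
        rw [Finset.union_eq_left.2 (Finset.mem_filter.1 hc).2]
      have hrest : ∑ c ∈ S.filter (fun c => ¬ jumps c ⊆ K), X (K ∪ jumps c) ∈ M := by
        refine Submodule.sum_mem _ fun c hc => ?_
        have hlt : K.card < (K ∪ jumps c).card := by
          refine Finset.card_lt_card (Finset.subset_union_left.ssubset_of_ne fun h => ?_)
          exact (Finset.mem_filter.1 hc).2 (Finset.union_eq_left.1 h.symm)
        have hle := (K ∪ jumps c).card_le_univ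
        rw [Fintype.card_fin] at hle
        exact ih _ (by omega) _ rfl (hK.trans Finset.subset_union_left)
      rw [hsame] at hprod
      have hX := (Submodule.add_mem_iff_left _ hrest).1 hprod
      refine (Submodule.smul_mem_iff _ ?_).1 hX
      rw [Nat.cast_ne_zero]
      exact Finset.card_ne_zero_of_mem h1S
  exact key _ K rfl hK

/-! ### The kernel of β -/

theorem canonicalIdeal_eq (hn : 1 ≤ n) : canonicalIdeal n = upperSpan (zeroSet n) := by
  have hex : ∀ J : Finset (Fin n), (∃ i ∈ J, (i : ℕ) = 0) ↔ zeroSet n ⊆ J := by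
    intro J
    constructor
    · rintro ⟨i, hi, h0⟩ j hj
      have : j = i := Fin.ext ((mem_zeroSet.1 hj).trans h0.symm)
      rwa [this]
    · intro h
      exact ⟨⟨0, hn⟩, h (mem_zeroSet.2 rfl), rfl⟩
  apply le_antisymm
  · rintro _ ⟨a, ha, rfl⟩
    have ha : beta n a = 0 := ha
    have hrep := (basisX n).sum_repr a
    have h0 : ∀ J, ¬ zeroSet n ⊆ J → (basisX n).repr a J = 0 := by
      -- β sends the X_J with 0 ∉ J to distinct basis elements, so their coefficients vanish on the
      -- kernel.
      have hinj : ∀ J K : Finset (Fin n), ¬ zeroSet n ⊆ J → ¬ zeroSet n ⊆ K →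
          shiftDown J = shiftDown K → J = K := by
        intro J K hJ hK h
        rw [← hex] at hJ hK
        ext i
        by_cases hi : (i : ℕ) = 0
        · exact iff_of_false (fun h => hJ ⟨i, h, hi⟩) (fun h => hK ⟨i, h, hi⟩)
        · have := Finset.ext_iff.1 h ⟨(i : ℕ) - 1, by omega⟩
          simp only [shiftDown, Finset.mem_filter, Finset.mem_univ, true_and] at this
          have hi' : (⟨(i : ℕ) - 1 + 1, by omega⟩ : Fin n) = i := Fin.ext (by simp only; omega)
          rwa [hi'] at this
      intro J hJ
      have h := congrArg (fun b => (basisX (n - 1)).repr b (shiftDown J)) ha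
      simp only [beta, Module.Basis.constr_apply_fintype, map_sum, Finsupp.coe_finsetSum,
        Finset.sum_apply, map_smul, Finsupp.smul_apply, map_zero, Finsupp.coe_zero, Pi.zero_apply,
        Module.Basis.equivFun_apply] at h
      rw [Finset.sum_eq_single J] at h
      · rw [if_neg (by rwa [hex])] at h
        simpa using h
      · intro K _ hne
        split_ifs with hK
        · simp
        · rw [Module.Basis.repr_self, Finsupp.single_apply, if_neg, smul_zero]
          exact fun h => hne (hinj _ _ (by rwa [← hex]) hJ h)
      · simp
    rw [← hrep, map_sum]
    refine Submodule.sum_mem _ fun J _ => ?_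
    rw [map_smul]
    by_cases hJ : zeroSet n ⊆ J
    · refine Submodule.smul_mem _ _ ?_
      change ((basisX n J : descentAlgebra n) : MonoidAlgebra ℚ (SignedPerm n)) ∈ _
      rw [coe_basisX]
      exact X_mem_upperSpan hJ
    · rw [h0 J hJ, zero_smul]
      exact Submodule.zero_mem _
  · refine Submodule.span_le.2 ?_
    rintro _ ⟨L, hL, rfl⟩
    refine ⟨⟨X L, X_mem L⟩, ?_, rfl⟩
    change beta n ⟨X L, X_mem L⟩ = 0
    refine Subtype.ext ?_
    rw [coe_beta_X, if_pos ((hex L).2 hL)]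
    rfl

theorem canonicalIdeal_isRightIdealGeneratedBy (hn : 1 ≤ n) :
    IsRightIdealGeneratedBy (descentAlgebra n) (canonicalIdeal n) (X0 ∅) := by
  rw [canonicalIdeal_eq hn, X0_empty]
  refine ⟨⟨⟨upperSpan_le_descentAlgebra _, fun y hy a ha => upperSpan_mul_mem subset_rfl hy ha⟩,
    X_mem_upperSpan subset_rfl⟩, ?_⟩
  rintro K ⟨⟨-, hK⟩, hx⟩ y hy
  obtain ⟨a, ha, rfl⟩ := upperSpan_zeroSet_le_mul hy
  exact hK _ hx _ ha

end TypeB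

/-! ### Counting the signings of a permutation with prescribed descents -/

namespace Peak

open SignedWord TypeB

variable {n : ℕ}

/-- The peaks that are larger than `a`. -/
def peaksFrom (a : ℕ) (u : Equiv.Perm (Fin n)) : Finset ℕ :=
  (Finset.Icc (a + 1) (n - 1)).filter fun i =>
    letter u (i - 1) < letter u i ∧ letter u (i + 1) < letter u i

theorem letter_succ (u : Equiv.Perm (Fin n)) (i : Fin n) : letter u ((i : ℕ) + 1) = (u i : ℕ) + 1 := by
  unfold letter
  rw [dif_pos ⟨by omega, by omega⟩]
  rfl

theorem letter_of_pos (u : Equiv.Perm (Fin n)) (i : Fin n) (h : (i : ℕ) ≠ 0) :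
    letter u i = (u ⟨(i : ℕ) - 1, by omega⟩ : ℕ) + 1 := by
  unfold letter
  rw [dif_pos ⟨by omega, by omega⟩]

theorem letter_zero (u : Equiv.Perm (Fin n)) : letter u 0 = 0 := by simp [letter]

theorem letter_ne (u : Equiv.Perm (Fin n)) (i : Fin n) :
    letter u i ≠ letter u ((i : ℕ) + 1) := by
  rw [letter_succ]
  by_cases h : (i : ℕ) = 0
  · rw [h, letter_zero]; omega
  · rw [letter_of_pos u i h]
    intro h'
    have := u.injective (Fin.ext (Nat.succ_injective h'))
    rw [Fin.ext_iff] at this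
    simp only at this
    omega

/-- The position whose sign decides whether a signing of `u` has a descent at `i`. -/
def decider (u : Equiv.Perm (Fin n)) (i : Fin n) : Fin n :=
  -- Index i carries the letter numbered i + 1. At i = 0 the first branch applies because u₀ = 0, so
  -- the truncated i - 1 is harmless.
  if letter u i < letter u ((i : ℕ) + 1) then i else ⟨(i : ℕ) - 1, by omega⟩

/-- The sign that the deciding position has if the descents at `i` are as prescribed by `J`. -/
def forcedSign (u : Equiv.Perm (Fin n)) (J : Finset ℕ) (i : Fin n) : ℤˣ :=
  if letter u i < letter u ((i : ℕ) + 1) ↔ (i : ℕ) ∈ J then -1 else 1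

/-- If the larger letter is on the right, a descent means that it is barred; if on the left, that it
is unbarred. -/
theorem mem_descents_iff_mem (u : Equiv.Perm (Fin n)) (ε : Fin n → ℤˣ) (J : Finset ℕ) (i : Fin n) :
    (i ∈ (SignedPerm.mk u ε).descents ↔ (i : ℕ) ∈ J) ↔ ε (decider u i) = forcedSign u J i := by
  have hne := letter_ne u i
  have hs := letter_succ u i
  rw [descents_eq, mem_desc]
  unfold decider forcedSign
  have hval : val (SignedPerm.mk u ε) i = (ε i : ℤ) * (letter u ((i : ℕ) + 1) : ℤ) := by
    rw [hs]; simp [val]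
  by_cases h0 : (i : ℕ) = 0
  · have hpre : pre (val (SignedPerm.mk u ε)) i = 0 := by simp [pre, h0]
    rw [hval, hpre]
    have h1 : letter u i < letter u ((i : ℕ) + 1) := by rw [h0, letter_zero, ← h0, hs]; omega
    have h2 : (0 : ℤ) < (letter u ((i : ℕ) + 1) : ℤ) := by exact_mod_cast (Nat.zero_le _).trans_lt h1
    simp only [h1, if_true, true_iff]
    rcases Int.units_eq_one_or (ε i) with h | h <;> rw [h] <;> by_cases hJ : (i : ℕ) ∈ J <;>
      simp [hJ] <;> omega
  · have hpre : pre (val (SignedPerm.mk u ε)) i =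
        (ε ⟨(i : ℕ) - 1, by omega⟩ : ℤ) * (letter u i : ℤ) := by
      rw [letter_of_pos u i h0]; simp [pre, h0, val]
    have hp : 0 < letter u i := by rw [letter_of_pos u i h0]; omega
    have hp' : 0 < letter u ((i : ℕ) + 1) := by omega
    rw [hval, hpre]
    rcases hne.lt_or_gt with h | h
    · simp only [h, if_true, true_iff]
      rcases Int.units_eq_one_or (ε i) with h1 | h1 <;>
        rcases Int.units_eq_one_or (ε ⟨(i : ℕ) - 1, by omega⟩) with h2 | h2 <;>
        rw [h1, h2] <;> by_cases hJ : (i : ℕ) ∈ J <;> simp [hJ] <;> omega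
    · simp only [h.not_gt, if_false, false_iff]
      rcases Int.units_eq_one_or (ε i) with h1 | h1 <;>
        rcases Int.units_eq_one_or (ε ⟨(i : ℕ) - 1, by omega⟩) with h2 | h2 <;>
        rw [h1, h2] <;> by_cases hJ : (i : ℕ) ∈ J <;> simp [hJ] <;> omega

/-- Signs are chosen independently: one choice at each constrained position, two elsewhere. -/
theorem card_signs_of_consistent (S : Finset (Fin n)) (p : Fin n → Fin n) (t : Fin n → ℤˣ)
    (h : ∀ i ∈ S, ∀ j ∈ S, p i = p j → t i = t j) :
    (Finset.univ.filter fun ε : Fin n → ℤˣ => ∀ i ∈ S, ε (p i) = t i).card =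
      2 ^ (n - (S.image p).card) := by
  have h1 : (Finset.univ.filter fun ε : Fin n → ℤˣ => ∀ i ∈ S, ε (p i) = t i) =
      Fintype.piFinset fun k => Finset.univ.filter fun e : ℤˣ => ∀ i ∈ S, p i = k → e = t i := by
    ext ε
    simp only [Finset.mem_filter, Finset.mem_univ, true_and, Fintype.mem_piFinset]
    exact ⟨fun h k i hi hk => hk ▸ h i hi, fun h i hi => h _ i hi rfl⟩
  have h2 : ∀ k, (Finset.univ.filter fun e : ℤˣ => ∀ i ∈ S, p i = k → e = t i).card =
      if k ∈ S.image p then 1 else 2 := by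
    intro k
    split_ifs with hk
    · obtain ⟨i, hi, rfl⟩ := Finset.mem_image.1 hk
      rw [Finset.card_eq_one]
      refine ⟨t i, ?_⟩
      ext e
      simp only [Finset.mem_filter, Finset.mem_univ, true_and, Finset.mem_singleton]
      exact ⟨fun h => h i hi rfl, fun he j hj hji => he.trans (h i hi j hj hji.symm)⟩
    · rw [Finset.filter_true_of_mem]
      · rfl
      · intro e _ i hi hik
        exact absurd (Finset.mem_image.2 ⟨i, hi, hik⟩) hk
  rw [h1, Fintype.card_piFinset]
  simp only [h2]
  rw [Finset.prod_ite, Finset.prod_const_one, one_mul, Finset.prod_const]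
  congr 1
  rw [Finset.filter_not, Finset.card_sdiff_of_subset (Finset.filter_subset _ _), Finset.card_univ,
    Fintype.card_fin]
  congr 2
  ext k; simp

/-- The positions from `a` on. -/
def positionsFrom (n a : ℕ) : Finset (Fin n) := Finset.univ.filter fun i => a ≤ (i : ℕ)

theorem mem_positionsFrom {a : ℕ} {i : Fin n} : i ∈ positionsFrom n a ↔ a ≤ (i : ℕ) := by
  simp [positionsFrom]

theorem mem_peaksFrom_of_decider_eq {a : ℕ} {u : Equiv.Perm (Fin n)} {i j : Fin n}
    (hi : a ≤ (i : ℕ)) (hij : i < j) (h : decider u i = decider u j) :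
    (j : ℕ) = i + 1 ∧ (j : ℕ) ∈ peaksFrom a u := by
  have hij : (i : ℕ) < j := hij
  have hj := letter_ne u j
  have h0 : ¬ letter u i < letter u ((i : ℕ) + 1) → (i : ℕ) ≠ 0 := fun h h' => h (by
    rw [h', letter_zero, ← h', letter_succ]; omega)
  unfold decider at h
  rw [Fin.ext_iff] at h
  split_ifs at h with h1 h2 h2 <;> try simp only at h
  · omega
  rotate_left
  · have := h0 h1; omega
  · have := h0 h1; omega
  refine ⟨by omega, ?_⟩
  have hji : (j : ℕ) = i + 1 := by omega
  have hj1 : (j : ℕ) - 1 = i := by omega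
  have hc : (i : ℕ) + 1 = j := by omega
  rw [hc] at h1
  rw [peaksFrom, Finset.mem_filter, Finset.mem_Icc, hj1]
  exact ⟨⟨by omega, by omega⟩, h1, by omega⟩

theorem decider_eq_of_mem_peaksFrom {a j : ℕ} {u : Equiv.Perm (Fin n)} (h : j ∈ peaksFrom a u) :
    ∃ i k : Fin n, a ≤ (i : ℕ) ∧ (k : ℕ) = j ∧ (k : ℕ) = i + 1 ∧
      letter u i < letter u ((i : ℕ) + 1) ∧ ¬ letter u k < letter u ((k : ℕ) + 1) ∧
      decider u i = i ∧ decider u k = i := by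
  rw [peaksFrom, Finset.mem_filter, Finset.mem_Icc] at h
  obtain ⟨⟨h1, h2⟩, h3, h4⟩ := h
  have hc : j - 1 + 1 = j := by omega
  have h5 : letter u (j - 1) < letter u (j - 1 + 1) := by rwa [hc]
  refine ⟨⟨j - 1, by omega⟩, ⟨j, by omega⟩, ?_, rfl, hc.symm, h5, h4.not_gt, if_pos h5,
    if_neg h4.not_gt⟩
  simp only; omega

/-- The only coincidences of deciders are between j - 1 and j for a peak j; discarding each such j
keeps the image and makes the map injective. -/
theorem card_image_decider (a : ℕ) (u : Equiv.Perm (Fin n)) :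
    ((positionsFrom n a).image (decider u)).card + (peaksFrom a u).card =
      (positionsFrom n a).card := by
  set S := positionsFrom n a
  have h1 : S.image (decider u) =
      (S.filter fun i : Fin n => (i : ℕ) ∉ peaksFrom a u).image (decider u) := by
    apply Finset.Subset.antisymm
    · intro k hk
      obtain ⟨i, hi, rfl⟩ := Finset.mem_image.1 hk
      by_cases hp : (i : ℕ) ∈ peaksFrom a u
      · obtain ⟨i', k', ha, hk, hki, hasc, -, hd1, hd2⟩ := decider_eq_of_mem_peaksFrom hp
        have : k' = i := Fin.ext hk
        subst this
        refine Finset.mem_image.2 ⟨i', Finset.mem_filter.2 ⟨mem_positionsFrom.2 ha, ?_⟩,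
          hd1.trans hd2.symm⟩
        intro h
        rw [peaksFrom, Finset.mem_filter] at h
        exact h.2.2.not_gt hasc
      · exact Finset.mem_image_of_mem _ (Finset.mem_filter.2 ⟨hi, hp⟩)
    · exact Finset.image_subset_image (Finset.filter_subset _ _)
  have h2 : Set.InjOn (decider u) (S.filter fun i : Fin n => (i : ℕ) ∉ peaksFrom a u) := by
    intro i hi j hj h
    rw [Finset.mem_coe, Finset.mem_filter, mem_positionsFrom] at hi hj
    rcases lt_trichotomy i j with hij | hij | hij
    · exact absurd (mem_peaksFrom_of_decider_eq hi.1 hij h).2 hj.2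
    · exact hij
    · exact absurd (mem_peaksFrom_of_decider_eq hj.1 hij h.symm).2 hi.2
  have h3 : (S.filter fun i : Fin n => (i : ℕ) ∈ peaksFrom a u).card = (peaksFrom a u).card := by
    refine Finset.card_bij (fun i _ => (i : ℕ)) ?_ (fun i _ j _ h => Fin.ext h) ?_
    · intro i hi; exact (Finset.mem_filter.1 hi).2
    · intro j hj
      obtain ⟨i, k, ha, hk, hki, -⟩ := decider_eq_of_mem_peaksFrom hj
      exact ⟨k, Finset.mem_filter.2 ⟨mem_positionsFrom.2 (by omega), by rwa [hk]⟩, hk⟩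
  rw [h1, Finset.card_image_of_injOn h2, ← h3, add_comm]
  exact Finset.card_filter_add_card_filter_not _

/-- The elements of `[1, n-1]` at which membership in `J` changes. -/
def boundary (n : ℕ) (J : Finset ℕ) : Finset ℕ :=
  (Finset.Icc 1 (n - 1)).filter fun j => ¬(j - 1 ∈ J ↔ j ∈ J)

/-- At a peak j the comparisons j - 1 and j constrain the same sign, and they agree exactly when one
of j - 1, j lies in J. -/
theorem card_signings (a : ℕ) (u : Equiv.Perm (Fin n)) (J : Finset ℕ) :
    (Finset.univ.filter fun ε : Fin n → ℤˣ => ∀ i ∈ positionsFrom n a,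
      (i ∈ (SignedPerm.mk u ε).descents ↔ (i : ℕ) ∈ J)).card =
    if peaksFrom a u ⊆ boundary n J then
      2 ^ (n - (positionsFrom n a).card + (peaksFrom a u).card) else 0 := by
  simp only [mem_descents_iff_mem]
  split_ifs with h
  · rw [card_signs_of_consistent]
    · congr 1
      have h1 := card_image_decider a u
      have h2 := (positionsFrom n a).card_le_univ
      rw [Fintype.card_fin] at h2
      omega
    · have key : ∀ i j : Fin n, a ≤ (i : ℕ) → i < j → decider u i = decider u j →
          forcedSign u J i = forcedSign u J j := by
        intro i j hi hij hd
        obtain ⟨h1, h2⟩ := mem_peaksFrom_of_decider_eq hi hij hd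
        have h3 := (Finset.mem_filter.1 (h h2)).2
        rw [peaksFrom, Finset.mem_filter] at h2
        rw [h1, Nat.add_sub_cancel] at h2 h3
        unfold forcedSign
        rw [h1]
        have h4 := h2.2.2.not_gt
        simp only [h2.2.1, h4, true_iff, false_iff]
        by_cases hJ : (i : ℕ) ∈ J <;> by_cases hJ' : (i : ℕ) + 1 ∈ J <;> simp_all
      intro i hi j hj hd
      rw [mem_positionsFrom] at hi hj
      rcases lt_trichotomy i j with hij | rfl | hij
      · exact key i j hi hij hd
      · rfl
      · exact (key j i hj hij hd.symm).symm
  · rw [Finset.card_eq_zero, Finset.filter_eq_empty_iff]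
    intro ε _ hε
    refine h fun j hj => ?_
    obtain ⟨i, k, ha, rfl, hki, hasc, hdes, hd1, hd2⟩ := decider_eq_of_mem_peaksFrom hj
    have h1 := hε i (mem_positionsFrom.2 ha)
    have h2 := hε k (mem_positionsFrom.2 (by omega))
    rw [hd1] at h1
    rw [hd2, h1] at h2
    unfold forcedSign at h2
    simp only [hasc, hdes, true_iff, false_iff] at h2
    rw [boundary, Finset.mem_filter, Finset.mem_Icc]
    refine ⟨⟨by omega, by omega⟩, ?_⟩
    rw [show (k : ℕ) - 1 = i by omega]
    by_cases hJ : (i : ℕ) ∈ J <;> by_cases hJ' : (k : ℕ) ∈ J <;> simp_all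

/-! ### Forgetting signs -/

/-- Forgetting the signs of a signed permutation. -/
def forgetHom (n : ℕ) : SignedPerm n →* Equiv.Perm (Fin n) where
  toFun w := w.perm
  map_one' := rfl
  map_mul' _ _ := rfl

/-- The algebra morphism `ℚB_n → ℚS_n` that forgets signs. -/
noncomputable def forget (n : ℕ) :
    MonoidAlgebra ℚ (SignedPerm n) →ₐ[ℚ] MonoidAlgebra ℚ (Equiv.Perm (Fin n)) :=
  MonoidAlgebra.mapDomainAlgHom ℚ ℚ (forgetHom n)

theorem forget_of (w : SignedPerm n) :
    forget n (MonoidAlgebra.of ℚ (SignedPerm n) w) =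
      MonoidAlgebra.of ℚ (Equiv.Perm (Fin n)) w.perm := by
  simp [forget, forgetHom]

/-- The sum of the permutations whose set of peaks larger than `a` is `F`. -/
noncomputable def PFrom (n a : ℕ) (F : Finset ℕ) : MonoidAlgebra ℚ (Equiv.Perm (Fin n)) :=
  ∑ u : Equiv.Perm (Fin n) with peaksFrom a u = F, MonoidAlgebra.of ℚ (Equiv.Perm (Fin n)) u

/-- The sum of the signed permutations whose descents from `a` on form the set `I`. -/
noncomputable def YFrom (a : ℕ) (I : Finset (Fin n)) : MonoidAlgebra ℚ (SignedPerm n) :=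
  ∑ w : SignedPerm n with w.descents ∩ positionsFrom n a = I, MonoidAlgebra.of ℚ (SignedPerm n) w

theorem forget_YFrom (a : ℕ) (J : Finset ℕ) :
    forget n (YFrom a ((positionsFrom n a).filter fun i : Fin n => (i : ℕ) ∈ J)) =
      ∑ F ∈ (boundary n J).powerset,
        (2 : ℚ) ^ (n - (positionsFrom n a).card + F.card) • PFrom n a F := by
  have hcond : ∀ w : SignedPerm n, (w.descents ∩ positionsFrom n a =
      ((positionsFrom n a).filter fun i : Fin n => (i : ℕ) ∈ J)) ↔
      ∀ i ∈ positionsFrom n a, (i ∈ w.descents ↔ (i : ℕ) ∈ J) := by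
    intro w
    simp only [Finset.ext_iff, Finset.mem_inter, Finset.mem_filter]
    exact forall_congr' fun i => by tauto
  have hl : forget n (YFrom a ((positionsFrom n a).filter fun i : Fin n => (i : ℕ) ∈ J)) =
      ∑ u : Equiv.Perm (Fin n), (if peaksFrom a u ⊆ boundary n J then
        (2 : ℚ) ^ (n - (positionsFrom n a).card + (peaksFrom a u).card) else 0) •
          MonoidAlgebra.of ℚ (Equiv.Perm (Fin n)) u := by
    simp only [YFrom, hcond, Finset.sum_filter]
    rw [← Equiv.sum_comp (SignedPerm.equivProd n).symm, Fintype.sum_prod_type, map_sum]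
    refine Finset.sum_congr rfl fun u _ => ?_
    rw [← Finset.sum_filter, map_sum]
    simp only [forget_of]
    change ∑ ε : Fin n → ℤˣ with ∀ i ∈ positionsFrom n a,
      (i ∈ (SignedPerm.mk u ε).descents ↔ (i : ℕ) ∈ J), MonoidAlgebra.of ℚ _ u = _
    rw [Finset.sum_const, card_signings, ← Nat.cast_smul_eq_nsmul ℚ]
    congr 1
    split_ifs <;> simp
  rw [hl]
  simp only [ite_smul, zero_smul]
  rw [← Finset.sum_filter, ← Finset.sum_fiberwise_of_maps_to
    (s := Finset.univ.filter fun u => peaksFrom a u ⊆ boundary n J)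
    (t := (boundary n J).powerset) (g := peaksFrom a) (by simp)]
  refine Finset.sum_congr rfl fun F hF => ?_
  rw [PFrom, Finset.smul_sum, Finset.filter_filter]
  refine Finset.sum_congr ?_ fun u hu => by rw [(Finset.mem_filter.1 hu).2]
  ext u
  simp only [Finset.mem_filter, Finset.mem_univ, true_and]
  exact ⟨fun h => h.2, fun h => ⟨h ▸ Finset.mem_powerset.1 hF, h⟩⟩

theorem X_eq_sum_YFrom (a : ℕ) {L : Finset (Fin n)} (hL : (positionsFrom n a)ᶜ ⊆ L) :
    X L = ∑ I ∈ (L ∩ positionsFrom n a).powerset, YFrom a I := by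
  rw [X_eq_sum, ← Finset.sum_fiberwise_of_maps_to (s := Finset.univ.filter fun w => w.descents ⊆ L)
    (t := (L ∩ positionsFrom n a).powerset)
    (g := fun w : SignedPerm n => w.descents ∩ positionsFrom n a)
    (fun w hw => Finset.mem_powerset.2
      (Finset.inter_subset_inter_right (Finset.mem_filter.1 hw).2))]
  refine Finset.sum_congr rfl fun I hI => Finset.sum_congr ?_ fun _ _ => rfl
  ext w
  simp only [Finset.mem_filter, Finset.mem_univ, true_and, and_iff_right_iff_imp]
  rintro rfl i hi
  by_cases h : i ∈ positionsFrom n a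
  · exact (Finset.mem_inter.1 (Finset.mem_powerset.1 hI (Finset.mem_inter.2 ⟨hi, h⟩))).1
  · exact hL (Finset.mem_compl.2 h)

/-- Triangular inversion of `X_eq_sum_YFrom`, by induction on I. -/
theorem YFrom_mem (a : ℕ) {I : Finset (Fin n)} (hI : I ⊆ positionsFrom n a) :
    YFrom a I ∈ upperSpan (positionsFrom n a)ᶜ := by
  induction I using Finset.strongInduction with
  | H I ih =>
    have hX := X_eq_sum_YFrom a (L := (positionsFrom n a)ᶜ ∪ I) Finset.subset_union_left
    have hinter : ((positionsFrom n a)ᶜ ∪ I) ∩ positionsFrom n a = I := by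
      ext i
      have := @hI i
      simp only [Finset.mem_inter, Finset.mem_union, Finset.mem_compl]
      tauto
    rw [hinter, ← Finset.add_sum_erase _ _ (Finset.mem_powerset_self I)] at hX
    have hmem : X ((positionsFrom n a)ᶜ ∪ I) ∈ upperSpan (positionsFrom n a)ᶜ :=
      X_mem_upperSpan Finset.subset_union_left
    rw [hX] at hmem
    refine (Submodule.add_mem_iff_left _ (Submodule.sum_mem _ fun I' hI' => ?_)).1 hmem
    have hss : I' ⊂ I := Finset.mem_ssubsets.1 hI'
    exact ih I' hss (hss.subset.trans hI)

theorem exists_boundary_eq {F : Finset ℕ} (hF : F ⊆ Finset.Icc 1 (n - 1)) :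
    ∃ J : Finset ℕ, boundary n J = F := by
  -- The parity of the number of elements of F up to i changes exactly at the elements of F.
  refine ⟨(Finset.range n).filter fun i => Odd (F.filter fun f => f ≤ i).card, ?_⟩
  ext j
  by_cases hj : j ∈ Finset.Icc 1 (n - 1)
  · have hj' := Finset.mem_Icc.1 hj
    have hcard : (F.filter fun f => f ≤ j).card =
        (F.filter fun f => f ≤ j - 1).card + if j ∈ F then 1 else 0 := by
      have : (F.filter fun f => f ≤ j) =
          (F.filter fun f => f ≤ j - 1) ∪ (F.filter fun f => f = j) := by
        ext f
        simp only [Finset.mem_filter, Finset.mem_union, ← and_or_left]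
        exact and_congr_right fun _ => by omega
      rw [this, Finset.card_union_of_disjoint, Finset.filter_eq']
      · split_ifs <;> simp
      · rw [Finset.disjoint_filter]; intro f _ h; omega
    have h1 : j < n := by omega
    have h2 : j - 1 < n := by omega
    rw [boundary, Finset.mem_filter]
    simp only [hj, true_and, Finset.mem_filter, Finset.mem_range, h1, h2, hcard]
    split_ifs with h <;> simp [h, Nat.odd_add_one, -Nat.not_odd_iff_even]
  · exact iff_of_false (fun h => hj (Finset.mem_filter.1 h).1) fun h => hj (hF h)

/-! ### The peak algebra and the peak ideal as images -/

/-- In `forget_YFrom` the term F = `boundary n J` has nonzero coefficient and all others are indexed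
by proper subsets. Every F is a boundary, so induction on F inverts the system. -/
theorem map_upperSpan (n a : ℕ) :
    (upperSpan (positionsFrom n a)ᶜ).map (forget n).toLinearMap =
      Submodule.span ℚ (PFrom n a '' {F | F ⊆ Finset.Icc 1 (n - 1)}) := by
  apply le_antisymm
  · rw [Submodule.map_le_iff_le_comap]
    refine Submodule.span_le.2 ?_
    rintro _ ⟨L, hL, rfl⟩
    change forget n (X L) ∈ Submodule.span ℚ (PFrom n a '' {F | F ⊆ Finset.Icc 1 (n - 1)})
    rw [X_eq_sum_YFrom a hL, map_sum]
    refine Submodule.sum_mem _ fun I hI => ?_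
    have hI' : I = (positionsFrom n a).filter fun i : Fin n => (i : ℕ) ∈ I.image Fin.val := by
      ext i
      rw [Finset.mem_filter, Finset.mem_image]
      constructor
      · intro hi
        exact ⟨(Finset.mem_inter.1 (Finset.mem_powerset.1 hI hi)).2, i, hi, rfl⟩
      · rintro ⟨-, j, hj, hji⟩
        rwa [← Fin.ext hji]
    rw [hI', forget_YFrom]
    refine Submodule.sum_mem _ fun F hF => Submodule.smul_mem _ _ (Submodule.subset_span ⟨F, ?_, rfl⟩)
    exact (Finset.mem_powerset.1 hF).trans (Finset.filter_subset _ _)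
  · refine Submodule.span_le.2 ?_
    rintro _ ⟨F, hF, rfl⟩
    change F ⊆ _ at hF
    change PFrom n a F ∈ (upperSpan (positionsFrom n a)ᶜ).map (forget n).toLinearMap
    induction F using Finset.strongInduction with
    | H F ih =>
      obtain ⟨J, hJ⟩ := exists_boundary_eq hF
      have hY := Submodule.mem_map_of_mem (f := (forget n).toLinearMap)
        (YFrom_mem a (Finset.filter_subset (fun i : Fin n => (i : ℕ) ∈ J) (positionsFrom n a)))
      rw [AlgHom.toLinearMap_apply, forget_YFrom, hJ,
        ← Finset.add_sum_erase _ _ (Finset.mem_powerset_self F)] at hY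
      refine (Submodule.smul_mem_iff _ (pow_ne_zero _ two_ne_zero)).1
        ((Submodule.add_mem_iff_left _ (Submodule.sum_mem _ fun G hG => ?_)).1 hY)
      have hss : G ⊂ F := Finset.mem_ssubsets.1 hG
      exact Submodule.smul_mem _ _ (ih G hss (hss.subset.trans hF))

/-- Makes the indexing by arbitrary subsets harmless: those that are not peak sets contribute
nothing. -/
theorem PFrom_eq_zero {a : ℕ} {F : Finset ℕ}
    (h : ¬(F ∈ peakSets n ∧ ∀ j ∈ F, a + 1 ≤ j)) : PFrom n a F = 0 := by
  rw [PFrom, Finset.filter_eq_empty_iff.2, Finset.sum_empty]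
  rintro u - rfl
  refine h ⟨⟨?_, ?_⟩, ?_⟩
  · refine (Finset.filter_subset _ _).trans (Finset.Icc_subset_Icc_left (by omega))
  · intro i hi hi'
    rw [peaksFrom, Finset.mem_filter] at hi hi'
    exact hi.2.2.not_gt hi'.2.1
  · intro j hj
    exact (Finset.mem_Icc.1 (Finset.mem_filter.1 hj).1).1

theorem span_PFrom_eq {a : ℕ} {T : Set (Finset ℕ)} (hT : T ⊆ {F | F ⊆ Finset.Icc 1 (n - 1)})
    (h : ∀ F ∈ peakSets n, (∀ j ∈ F, a + 1 ≤ j) → F ∈ T) :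
    Submodule.span ℚ (PFrom n a '' {F | F ⊆ Finset.Icc 1 (n - 1)}) =
      Submodule.span ℚ (PFrom n a '' T) := by
  refine le_antisymm (Submodule.span_le.2 ?_) (Submodule.span_mono (Set.image_mono hT))
  rintro _ ⟨F, -, rfl⟩
  by_cases hF : F ∈ peakSets n ∧ ∀ j ∈ F, a + 1 ≤ j
  · exact Submodule.subset_span ⟨F, h F hF.1 hF.2, rfl⟩
  · rw [PFrom_eq_zero hF]
    exact Submodule.zero_mem _

theorem peakAlgebra_eq_map (n : ℕ) :
    peakAlgebra n = (descentAlgebra n).map (forget n).toLinearMap := by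
  have h0 : (positionsFrom n 0)ᶜ = ∅ := by ext i; simp [mem_positionsFrom]
  rw [← upperSpan_empty, ← h0, map_upperSpan,
    span_PFrom_eq (T := peakSets n) (fun F hF => hF.1) fun F hF _ => hF]
  rfl

theorem zeroSet_eq (n : ℕ) : zeroSet n = (positionsFrom n 1)ᶜ := by
  ext i; simp [mem_positionsFrom, mem_zeroSet]

theorem peakIdeal_eq_map (n : ℕ) :
    peakIdeal n = (upperSpan (zeroSet n)).map (forget n).toLinearMap := by
  rw [zeroSet_eq, map_upperSpan,
    span_PFrom_eq (T := {F | F ∈ peakSets n ∧ 1 ∉ F}) (fun F hF => hF.1.1)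
      fun F hF h => ⟨hF, fun h1 => absurd (h 1 h1) (by norm_num)⟩]
  rfl

/-- The case J = ∅ of the signing count: the boundary is empty, so only F = ∅ survives. -/
theorem forget_X_zeroSet (n : ℕ) :
    ∃ c : ℚ, c ≠ 0 ∧ forget n (X (zeroSet n)) = c • Pint n ∅ := by
  refine ⟨2 ^ (n - (positionsFrom n 1).card), pow_ne_zero _ two_ne_zero, ?_⟩
  have hb : boundary n ∅ = ∅ := by simp [boundary]
  have h := forget_YFrom (n := n) 1 ∅
  rw [hb, Finset.powerset_empty, Finset.sum_singleton, Finset.card_empty, add_zero] at h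
  rw [zeroSet_eq, X_eq_sum_YFrom 1 subset_rfl, Finset.inter_comm, Finset.inter_compl, Finset.powerset_empty,
    Finset.sum_singleton]
  simp only [Finset.notMem_empty, Finset.filter_false] at h
  exact h

theorem peakAlgebra_isUnitalSubalgebra (n : ℕ) : IsUnitalSubalgebra (peakAlgebra n) := by
  rw [peakAlgebra_eq_map]
  obtain ⟨h1, hmul⟩ := descentAlgebra_isUnitalSubalgebra n
  refine ⟨⟨1, h1, map_one (forget n)⟩, ?_⟩
  rintro _ ⟨a, ha, rfl⟩ _ ⟨b, hb, rfl⟩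
  exact ⟨a * b, hmul a ha b hb, map_mul (forget n) a b⟩

theorem peakIdeal_isRightIdealGeneratedBy (n : ℕ) :
    IsRightIdealGeneratedBy (peakAlgebra n) (peakIdeal n) (Pint n ∅) := by
  rw [peakAlgebra_eq_map, peakIdeal_eq_map]
  obtain ⟨c, hc, hX⟩ := forget_X_zeroSet n
  refine ⟨⟨⟨Submodule.map_mono (upperSpan_le_descentAlgebra _), ?_⟩, ?_⟩, ?_⟩
  · rintro _ ⟨y, hy, rfl⟩ _ ⟨a, ha, rfl⟩
    exact ⟨y * a, upperSpan_mul_mem subset_rfl hy ha, map_mul (forget n) y a⟩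
  · refine (Submodule.smul_mem_iff _ hc).1 ?_
    rw [← hX]
    exact ⟨_, X_mem_upperSpan subset_rfl, rfl⟩
  · rintro K ⟨⟨-, hK⟩, hx⟩ _ ⟨y, hy, rfl⟩
    obtain ⟨a, ha, rfl⟩ := upperSpan_zeroSet_le_mul hy
    change forget n (X (zeroSet n) * a) ∈ K
    rw [map_mul, hX]
    exact hK _ (Submodule.smul_mem _ _ hx) _ ⟨a, ha, rfl⟩

end Peak

theorem mainTheorem10 (n : ℕ) :
    (1 ≤ n →
      IsUnitalSubalgebra (TypeB.descentAlgebra n) ∧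
      IsRightIdealGeneratedBy (TypeB.descentAlgebra n) (TypeB.canonicalIdeal n) (TypeB.X0 ∅)) ∧
    IsUnitalSubalgebra (Peak.peakAlgebra n) ∧
    IsRightIdealGeneratedBy (Peak.peakAlgebra n) (Peak.peakIdeal n) (Peak.Pint n ∅) :=
  ⟨fun hn => ⟨TypeB.descentAlgebra_isUnitalSubalgebra n,
    TypeB.canonicalIdeal_isRightIdealGeneratedBy hn⟩,
    Peak.peakAlgebra_isUnitalSubalgebra n, Peak.peakIdeal_isRightIdealGeneratedBy n⟩
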